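/- Let $\mathcal G\rightrightarrows X$ be a local symplectic groupoid: a local Lie groupoid (source $s$ and target $t$ submersions onto the $n$-dimensional manifold $X$, unit map, inversion $\tau$, and a smooth multiplication $(\beta,\alpha)\mapsto\beta\alpha$ defined on a relatively open subset of $\{s(\beta)=t(\alpha)\}$ that contains all pairs $(\alpha,1_{s(\alpha)})$, $(1_{t(\alpha)},\alpha)$, $(\alpha,\alpha^{-1})$, $(\alpha^{-1},\alpha)$) together with a symplectic form $\omega$ on $\mathcal G$ for which the graph $\{(\beta\alpha,\beta,\alpha)\}$ is a Lagrangian submanifold of $(\mathcal G,-\omega)\times(\mathcal G,\omega)\times(\mathcal G,\omega)$. (Global symplectic groupoids are included.) Let $\Sigma\subset\mathcal G$ be a bisection, i.e. a closed embedded submanifold on which $s$ and $t$ restrict to diffeomorphisms onto $X$, and put $$\Sigma_s=(s|_\Sigma)^{-1},\quad \Sigma_t=(t|_\Sigma)^{-1},\quad l_\Sigma=t\circ\Sigma_s,\quad r_\Sigma=s\circ\Sigma_t,\quad F^s=\Sigma_s^*\omega,\quad F^t=\Sigma_t^*\omega .$$ Let $R_\Sigma(g)=g\cdot\Sigma_t(s(g))$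 and $R_{\Sigma^{-1}}(g)=g\cdot(\Sigma_s(s(g)))^{-1}$ be the right actions of $\Sigma$ and $\Sigma^{-1}$, defined near the units and near $\Sigma$ respectively. Around the unit at each $y\in X$ fix local coordinates $(x^i,p_j)_{1\le i,j\le n}$ of $\mathcal G$ such that the $x^i$ are pulled back by $s$ from coordinates on $X$ and the units are given by $p=0$. For $x\in X$, taking the coordinates around the unit at $l_\Sigma(x)$, let $\Pi_j=p_j\circ R_{\Sigma^{-1}}$ be the gauge-invariant momenta near $\Sigma_s(x)$, and let $$\mathcal F_{jk}(x)=\{\Pi_j,\Pi_k\}(\Sigma_s(x)),$$ where $\{f,h\}=dh(X_f)$ with $\omega(X_f,\cdot)=df$ is the Poisson bracket of $\omega$. Then: (1) $F^s=0\iff F^t=0\iff\mathcal F=0\iff\Sigma$ is a Lagrangian submanifold of $(\mathcal G,\omega)$. (2) $F^t=r_\Sigma^*F^s$ and $F^s=l_\Sigma^*F^t$. (3) For $x\in X$ and $y=l_\Sigma(x)$, write $\mathcal F=\mathcal F(x)$ and let $F^t$ denote the matrix $F^t(\partial_l,\partial_m)$ at $y$. Let $\Gamma^m_l=(R_\Sigma^*\omega)(\partial_{p}^m,\partial_{x^l})$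 (row index $m$, column index $l$) and $\Xi^{lm}=(R_\Sigma^*\omega)(\partial_p^l,\partial_p^m)$ at the unit at $y$. Then $\Gamma$ is invertible and, with $\overline\Gamma=\Gamma^{-1}$ and $\widehat\Xi=\overline\Gamma\,\Xi\,\overline\Gamma^{T}$, the matrices $\mathbb I+\overline\Gamma^TF^t\,\overline\Gamma\,\Xi$ and $\mathbb I-\Gamma^T\mathcal F\,\Gamma\,\widehat\Xi$ are invertible and $$\mathcal F=\bigl(\mathbb I+\overline\Gamma^TF^t\,\overline\Gamma\,\Xi\bigr)^{-1}\overline\Gamma^TF^t\,\overline\Gamma,\qquad F^t=\bigl(\mathbb I-\Gamma^T\mathcal F\,\Gamma\,\widehat\Xi\bigr)^{-1}\Gamma^T\mathcal F\,\Gamma .$$ -/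

import Mathlib

open Set Filter Topology
open scoped Manifold ContDiff Matrix

noncomputable section

namespace PoissonED

/-! ### Two-forms, submanifolds, Lagrangian submanifolds -/

section Forms

variable {E : Type*} [NormedAddCommGroup E] [NormedSpace ℝ E] {H : Type*} [TopologicalSpace H]
  {E' : Type*} [NormedAddCommGroup E'] [NormedSpace ℝ E'] {H' : Type*} [TopologicalSpace H']

/-- A (not necessarily smooth) two-form on `M`: an alternating bilinear form on each tangent
space. -/
abbrev TwoForm (I : ModelWithCorners ℝ E H) (M : Type*) [TopologicalSpace M]
    [ChartedSpace H M] : Type _ :=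
  ∀ p : M, (TangentSpace I p) [⋀^Fin 2]→L[ℝ] ℝ

/-- The pull-back `f^* ω` of a two-form along a map `f : M → M'`. -/
def pullback (I : ModelWithCorners ℝ E H) (I' : ModelWithCorners ℝ E' H')
    {M : Type*} [TopologicalSpace M] [ChartedSpace H M]
    {M' : Type*} [TopologicalSpace M'] [ChartedSpace H' M']
    (f : M → M') (om : TwoForm I' M') : TwoForm I M :=
  fun p => (om (f p)).compContinuousLinearMap (mfderiv I I' f p)

/-- The expression of a two-form in the chart around `x₀`, a two-form on the model space `E`
(only meaningful on the target of the chart). -/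
def chartExpr {M : Type*} [TopologicalSpace M] [ChartedSpace E M]
    (om : TwoForm 𝓘(ℝ, E) M) (x₀ : M) : E → E [⋀^Fin 2]→L[ℝ] ℝ :=
  pullback 𝓘(ℝ, E) 𝓘(ℝ, E) (extChartAt 𝓘(ℝ, E) x₀).symm om

/-- A symplectic form: a smooth, closed, non-degenerate two-form. -/
structure IsSymplectic {M : Type*} [TopologicalSpace M] [ChartedSpace E M]
    (om : TwoForm 𝓘(ℝ, E) M) : Prop where
  smooth : ∀ x₀ : M, ContDiffOn ℝ ∞ (chartExpr om x₀) (extChartAt 𝓘(ℝ, E) x₀).target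
  closed : ∀ x₀ : M, ∀ e ∈ (extChartAt 𝓘(ℝ, E) x₀).target, extDeriv (chartExpr om x₀) e = 0
  nondegenerate : ∀ (p : M) (v : TangentSpace 𝓘(ℝ, E) p),
    (∀ w : TangentSpace 𝓘(ℝ, E) p, om p ![v, w] = 0) → v = 0

/-- `S` is a smooth embedded submanifold of `M`: around each of its points there is a chart of `M`
in which `S` is a linear slice. -/
def IsEmbeddedSubmanifold (I : ModelWithCorners ℝ E H) {M : Type*} [TopologicalSpace M]
    [ChartedSpace H M] (S : Set M) : Prop :=
  ∀ p ∈ S, ∃ φ ∈ IsManifold.maximalAtlas I ∞ M, p ∈ φ.source ∧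
    ∃ V : Submodule ℝ E, ∀ q ∈ φ.source, q ∈ S ↔ φ.extend I q ∈ V

/-- The tangent space at `p` of the submanifold `S`: the velocities at time `0` of the smooth
curves through `p` that stay in `S`. -/
def tangentSet (I : ModelWithCorners ℝ E H) {M : Type*} [TopologicalSpace M]
    [ChartedSpace H M] (S : Set M) (p : M) : Set (TangentSpace I p) :=
  {v | ∃ c : ℝ → M, ContMDiffAt 𝓘(ℝ, ℝ) I ∞ c 0 ∧ (∀ᶠ t in 𝓝 (0 : ℝ), c t ∈ S) ∧
    (⟨c 0, mfderiv 𝓘(ℝ, ℝ) I c 0 (1 : ℝ)⟩ : TangentBundle I M) = ⟨p, v⟩}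

/-- `S` is a Lagrangian submanifold for `ω`: an embedded submanifold each of whose tangent spaces
equals its own `ω`-orthogonal. -/
def IsLagrangianSubmanifold (I : ModelWithCorners ℝ E H) {M : Type*} [TopologicalSpace M]
    [ChartedSpace H M] (om : TwoForm I M) (S : Set M) : Prop :=
  IsEmbeddedSubmanifold I S ∧
    ∀ p ∈ S, ∀ v : TangentSpace I p,
      v ∈ tangentSet I S p ↔ ∀ w ∈ tangentSet I S p, om p ![v, w] = 0

open Classical in
/-- The vector `v` at `p` with `ω(v, ·) = α`; it exists and is unique when `ω` is non-degenerate on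
a finite-dimensional tangent space. -/
def sharp {I : ModelWithCorners ℝ E H} {M : Type*} [TopologicalSpace M]
    [ChartedSpace H M] (om : TwoForm I M) (p : M) (α : TangentSpace I p →L[ℝ] ℝ) :
    TangentSpace I p :=
  if h : ∃ v : TangentSpace I p, ∀ w : TangentSpace I p, om p ![v, w] = α w then h.choose else 0

/-- The Poisson bracket `{f, h}(p) = dh(X_f)`, where `ω(X_f, ·) = df`. For `ω = ∑ dp_i ∧ dx^i` this
is the bracket with `{x^i, p_j} = δ^i_j`. -/
def poissonBracket {I : ModelWithCorners ℝ E H} {M : Type*} [TopologicalSpace M]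
    [ChartedSpace H M] (om : TwoForm I M) (f h : M → ℝ) (p : M) : ℝ :=
  mfderiv I 𝓘(ℝ, ℝ) h p (sharp om p (mfderiv I 𝓘(ℝ, ℝ) f p))

end Forms

/-! ### Local symplectic groupoids -/

section Groupoid

variable (n d : ℕ) (G X : Type*)
  [TopologicalSpace G] [ChartedSpace (EuclideanSpace ℝ (Fin d)) G]
  [TopologicalSpace X] [ChartedSpace (EuclideanSpace ℝ (Fin n)) X]

/-- A local Lie groupoid `G ⇉ X`. A pair `(β, α)` can be multiplied only if it lies in `dom`, which
is a relatively open subset of the set of pairs with `s(β) = t(α)`; the value of `mul` elsewhere is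
irrelevant. The choice `dom = {s(β) = t(α)}` gives the (global) Lie groupoids. -/
structure LocalLieGroupoid where
  src : G → X
  tgt : G → X
  unit : X → G
  inv : Diffeomorph (𝓡 d) (𝓡 d) G G ∞
  dom : Set (G × G)
  mul : G × G → G
  src_submersion : Manifold.IsSubmersion (𝓡 d) (𝓡 n) ∞ src
  tgt_submersion : Manifold.IsSubmersion (𝓡 d) (𝓡 n) ∞ tgt
  unit_smooth : ContMDiff (𝓡 n) (𝓡 d) ∞ unit
  src_unit : ∀ x, src (unit x) = x
  tgt_unit : ∀ x, tgt (unit x) = x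
  dom_open : ∃ U : Set (G × G), IsOpen U ∧ dom = U ∩ {q | src q.1 = tgt q.2}
  mul_smooth : ContMDiffOn ((𝓡 d).prod (𝓡 d)) (𝓡 d) ∞ mul dom
  src_mul : ∀ β α, (β, α) ∈ dom → src (mul (β, α)) = src α
  tgt_mul : ∀ β α, (β, α) ∈ dom → tgt (mul (β, α)) = tgt β
  unit_dom : ∀ α, (α, unit (src α)) ∈ dom ∧ (unit (tgt α), α) ∈ dom
  mul_unit : ∀ α, mul (α, unit (src α)) = α
  unit_mul : ∀ α, mul (unit (tgt α), α) = α
  inv_dom : ∀ α, (α, inv α) ∈ dom ∧ (inv α, α) ∈ dom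
  mul_inv : ∀ α, mul (α, inv α) = unit (tgt α)
  inv_mul : ∀ α, mul (inv α, α) = unit (src α)
  mul_assoc : ∀ γ β α, (γ, β) ∈ dom → (β, α) ∈ dom → (mul (γ, β), α) ∈ dom →
    (γ, mul (β, α)) ∈ dom → mul (γ, mul (β, α)) = mul (mul (γ, β), α)

/-- The two-form `(-ω) ⊕ ω ⊕ ω` on `G × G × G`. -/
def tripleForm {d : ℕ} {G : Type*} [TopologicalSpace G]
    [ChartedSpace (EuclideanSpace ℝ (Fin d)) G] (om : TwoForm (𝓡 d) G) :
    TwoForm ((𝓡 d).prod ((𝓡 d).prod (𝓡 d))) (G × G × G) := fun q =>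
  - pullback ((𝓡 d).prod ((𝓡 d).prod (𝓡 d))) (𝓡 d) (fun q : G × G × G => q.1) om q
  + pullback ((𝓡 d).prod ((𝓡 d).prod (𝓡 d))) (𝓡 d) (fun q : G × G × G => q.2.1) om q
  + pullback ((𝓡 d).prod ((𝓡 d).prod (𝓡 d))) (𝓡 d) (fun q : G × G × G => q.2.2) om q

/-- A local symplectic groupoid: a local Lie groupoid with a symplectic form for which the graph
`{(βα, β, α)}` of the multiplication is Lagrangian in `(G, -ω) × (G, ω) × (G, ω)`. -/
structure LocalSymplecticGroupoid extends LocalLieGroupoid n d G X where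
  om : TwoForm (𝓡 d) G
  symplectic : IsSymplectic om
  graph_lagrangian : IsLagrangianSubmanifold ((𝓡 d).prod ((𝓡 d).prod (𝓡 d))) (tripleForm om)
    {q : G × G × G | (q.2.1, q.2.2) ∈ dom ∧ q.1 = mul (q.2.1, q.2.2)}

variable {n d G X}

/-- A bisection: a closed embedded submanifold `Σ ⊆ G` on which `s` and `t` restrict to
diffeomorphisms onto `X`. The inverse diffeomorphisms, viewed as maps `X → G`, are
`Σ_s = (s|_Σ)⁻¹` and `Σ_t = (t|_Σ)⁻¹`; they are determined by the submanifold. -/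
structure Bisection (𝒢 : LocalSymplecticGroupoid n d G X) where
  carrier : Set G
  isClosed : IsClosed carrier
  embedded : IsEmbeddedSubmanifold (𝓡 d) carrier
  srcSec : X → G
  tgtSec : X → G
  srcSec_smooth : ContMDiff (𝓡 n) (𝓡 d) ∞ srcSec
  tgtSec_smooth : ContMDiff (𝓡 n) (𝓡 d) ∞ tgtSec
  srcSec_mem : ∀ x, srcSec x ∈ carrier
  tgtSec_mem : ∀ x, tgtSec x ∈ carrier
  src_srcSec : ∀ x, 𝒢.src (srcSec x) = x
  tgt_tgtSec : ∀ x, 𝒢.tgt (tgtSec x) = x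
  srcSec_src : ∀ g ∈ carrier, srcSec (𝒢.src g) = g
  tgtSec_tgt : ∀ g ∈ carrier, tgtSec (𝒢.tgt g) = g

namespace Bisection

variable {𝒢 : LocalSymplecticGroupoid n d G X} (S : Bisection 𝒢)

/-- `l_Σ = t ∘ Σ_s`. -/
def l (x : X) : X := 𝒢.tgt (S.srcSec x)

/-- `r_Σ = s ∘ Σ_t`. -/
def r (x : X) : X := 𝒢.src (S.tgtSec x)

/-- The field strength `F^s = Σ_s^* ω`. -/
def Fs : TwoForm (𝓡 n) X := pullback (𝓡 n) (𝓡 d) S.srcSec 𝒢.om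

/-- The field strength `F^t = Σ_t^* ω`. -/
def Ft : TwoForm (𝓡 n) X := pullback (𝓡 n) (𝓡 d) S.tgtSec 𝒢.om

/-- The right action `R_Σ(g) = g Σ`: multiply `g` from the right by the point of `Σ` whose target
is `s(g)`. It is defined near the units. -/
def R (g : G) : G := 𝒢.mul (g, S.tgtSec (𝒢.src g))

/-- The right action `R_{Σ⁻¹}(g) = g Σ⁻¹` of the inverse bisection `Σ⁻¹ = {σ⁻¹ | σ ∈ Σ}`: the point
of `Σ⁻¹` whose target is `s(g)` is the inverse of `Σ_s(s(g))`. It is defined near `Σ`. -/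
def RInv (g : G) : G := 𝒢.mul (g, 𝒢.inv (S.srcSec (𝒢.src g)))

end Bisection

/-- Local coordinates `(x, p)` of `G` around the unit at `y`: the `x^i` are the pull-backs by the
source map of coordinates on `X`, and the units are given by `p = 0`. -/
structure MomentumChart (𝒢 : LocalSymplecticGroupoid n d G X) (y : X) where
  base : OpenPartialHomeomorph X (EuclideanSpace ℝ (Fin n))
  chart : OpenPartialHomeomorph G (EuclideanSpace ℝ (Fin n) × EuclideanSpace ℝ (Fin n))
  base_mem : base ∈ IsManifold.maximalAtlas (𝓡 n) ∞ X
  chart_smooth : ContMDiffOn (𝓡 d) 𝓘(ℝ, EuclideanSpace ℝ (Fin n) × EuclideanSpace ℝ (Fin n)) ∞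
    chart chart.source
  chart_symm_smooth : ContMDiffOn
    𝓘(ℝ, EuclideanSpace ℝ (Fin n) × EuclideanSpace ℝ (Fin n)) (𝓡 d) ∞ chart.symm chart.target
  unit_mem : 𝒢.unit y ∈ chart.source
  src_mem : ∀ g ∈ chart.source, 𝒢.src g ∈ base.source
  fst_chart : ∀ g ∈ chart.source, (chart g).1 = base (𝒢.src g)
  snd_chart : ∀ g ∈ chart.source, (chart g).2 = 0 ↔ g ∈ range 𝒢.unit

namespace Bisection

variable {𝒢 : LocalSymplecticGroupoid n d G X} (S : Bisection 𝒢)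

/-- The gauge-invariant momenta `Π_j = p_j ∘ R_{Σ⁻¹}`, defined near `Σ_s(x)` when `(x, p)` are
coordinates around the unit at `l_Σ(x)`. -/
def gaugeMomentum {y : X} (P : MomentumChart 𝒢 y) (j : Fin n) (g : G) : ℝ :=
  (P.chart (S.RInv g)).2 j

/-- The field strength `𝓕_{jk}(x) = {Π_j, Π_k}(Σ_s(x))`. -/
def calF (P : ∀ y, MomentumChart 𝒢 y) (x : X) : Matrix (Fin n) (Fin n) ℝ :=
  Matrix.of fun j k => poissonBracket 𝒢.om
    (S.gaugeMomentum (P (S.l x)) j) (S.gaugeMomentum (P (S.l x)) k) (S.srcSec x)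

/-- The components `F^t_{lm}(y) = F^t(∂_l, ∂_m)`. -/
def FtMatrix {y : X} (P : MomentumChart 𝒢 y) : Matrix (Fin n) (Fin n) ℝ :=
  Matrix.of fun l m =>
    pullback (𝓡 n) (𝓡 n) P.base.symm S.Ft (P.base y)
      ![EuclideanSpace.single l (1 : ℝ), EuclideanSpace.single m (1 : ℝ)]

/-- The form `R_Σ^* ω` in coordinates `(y, π)` around the unit at `y`, evaluated at that unit. -/
def RForm {y : X} (P : MomentumChart 𝒢 y)
    (v w : EuclideanSpace ℝ (Fin n) × EuclideanSpace ℝ (Fin n)) : ℝ :=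
  pullback 𝓘(ℝ, EuclideanSpace ℝ (Fin n) × EuclideanSpace ℝ (Fin n)) (𝓡 d) P.chart.symm
    (pullback (𝓡 d) (𝓡 d) S.R 𝒢.om) (P.chart (𝒢.unit y)) ![v, w]

/-- The mixed block `Γ^m_l = (R_Σ^* ω)(∂_π^m, ∂_l)`, with row index `m` and column index `l`. -/
def Gam {y : X} (P : MomentumChart 𝒢 y) : Matrix (Fin n) (Fin n) ℝ :=
  Matrix.of fun m l =>
    S.RForm P (0, EuclideanSpace.single m (1 : ℝ)) (EuclideanSpace.single l (1 : ℝ), 0)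

/-- The momentum block `Ξ^{lm} = (R_Σ^* ω)(∂_π^l, ∂_π^m)`. -/
def Xi {y : X} (P : MomentumChart 𝒢 y) : Matrix (Fin n) (Fin n) ℝ :=
  Matrix.of fun l m =>
    S.RForm P (0, EuclideanSpace.single l (1 : ℝ)) (0, EuclideanSpace.single m (1 : ℝ))

end Bisection

end Groupoid

end PoissonED

end

open PoissonED

/-! Because the graph of the multiplication is isotropic for `(-ω) ⊕ ω ⊕ ω`, the form `ω` is
multiplicative: along composable families, `ω` on the product is the sum of `ω` on the factors
(`LocalSymplecticGroupoid.val_mul`). Applied to `1·1 = 1` this makes the units isotropic; applied to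
`R_Σ(g) = g·Σ_t(s(g))` it gives `R_Σ^*ω = ω + s^*F^t` at the units.

In coordinates `(x, p)` the term `s^*F^t` does not see the `p`-directions, and `R_Σ` restricted to
the units is `Σ_t`. Hence `R_Σ^*ω` at the unit has `xx`-block `F^t`, `pp`-block `Ξ`, and a mixed
block `Γ` that agrees with that of `ω`; `Γ` is invertible because `ω` is non-degenerate and the
units are isotropic.

Near `Σ` the map `R_{Σ⁻¹}` inverts `R_Σ`, so `R_Σ` turns `Π_j` into the coordinate `p_j`. The
Hamiltonian vectors of the `Π_j`, written in coordinates as rows `(a, Φ)`, therefore satisfy `aF +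
ΦΓ = 0` and `ΦΞ - aΓᵀ = 1`, and `Φ` is the bracket matrix `𝓕`. Eliminating `a` yields both matrix
formulas (`isUnit_and_schur_of_block_inverse`), hence the simultaneous vanishing of `F^t` and `𝓕`.

The remaining claims are formal: `Σ_t = Σ_s ∘ r_Σ` and `Σ_s = Σ_t ∘ l_Σ` relate `F^s` and `F^t`, and
`F^s = 0` says that `Σ` is isotropic, which suffices for Lagrangian since `d = 2n`. -/

noncomputable section

namespace PoissonED

/-! ### Derivatives and two-forms on the model spaces -/

section Derivatives

variable {E : Type*} [NormedAddCommGroup E] [NormedSpace ℝ E] {H : Type*} [TopologicalSpace H]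
  {E' : Type*} [NormedAddCommGroup E'] [NormedSpace ℝ E'] {H' : Type*} [TopologicalSpace H']
  {E'' : Type*} [NormedAddCommGroup E''] [NormedSpace ℝ E''] {H'' : Type*} [TopologicalSpace H'']
  {I : ModelWithCorners ℝ E H} {I' : ModelWithCorners ℝ E' H'} {I'' : ModelWithCorners ℝ E'' H''}
  {M : Type*} [TopologicalSpace M] [ChartedSpace H M]
  {M' : Type*} [TopologicalSpace M'] [ChartedSpace H' M']
  {M'' : Type*} [TopologicalSpace M''] [ChartedSpace H'' M'']

variable (I I') in
/-- The derivative of a map of manifolds, as a map between the model vector spaces. -/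
def modelDeriv (f : M → M') (x : M) : E →L[ℝ] E' := mfderiv I I' f x

/-- The value of a two-form, as a function on the model vector space. -/
def TwoForm.val (om : TwoForm I M) (p : M) (v w : E) : ℝ := om p ![v, w]

theorem modelDeriv_comp {g : M' → M''} {f : M → M'} {x : M} {y : M'}
    (hg : ContMDiffAt I' I'' ∞ g y) (hf : ContMDiffAt I I' ∞ f x) (hy : f x = y) :
    modelDeriv I I'' (g ∘ f) x = (modelDeriv I' I'' g y).comp (modelDeriv I I' f x) := by
  subst hy
  exact mfderiv_comp x (hg.mdifferentiableAt (by simp)) (hf.mdifferentiableAt (by simp))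

theorem modelDeriv_comp_apply {g : M' → M''} {f : M → M'} {x : M} {y : M'}
    (hg : ContMDiffAt I' I'' ∞ g y) (hf : ContMDiffAt I I' ∞ f x) (hy : f x = y) (v : E) :
    modelDeriv I I'' (g ∘ f) x v = modelDeriv I' I'' g y (modelDeriv I I' f x v) := by
  rw [modelDeriv_comp hg hf hy]; rfl

theorem modelDeriv_congr {f g : M → M'} {x : M} (h : f =ᶠ[𝓝 x] g) :
    modelDeriv I I' f x = modelDeriv I I' g x :=
  h.mfderiv_eq

theorem modelDeriv_apply_of_eventually_leftInverse {g : M' → M} {f : M → M'} {x : M} {y : M'}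
    (hg : ContMDiffAt I' I ∞ g y) (hf : ContMDiffAt I I' ∞ f x) (hy : f x = y)
    (h : ∀ᶠ z in 𝓝 x, g (f z) = z) (v : E) :
    modelDeriv I' I g y (modelDeriv I I' f x v) = v := by
  rw [← modelDeriv_comp_apply hg hf hy, modelDeriv_congr (f := g ∘ f) (g := id) h]
  exact DFunLike.congr_fun mfderiv_id v

theorem modelDeriv_eq_fderiv {f : E → E'} {x : E} :
    modelDeriv 𝓘(ℝ, E) 𝓘(ℝ, E') f x = fderiv ℝ f x :=
  mfderiv_eq_fderiv

theorem modelDeriv_prodMk {f : M → M'} {g : M → M''} {x : M}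
    (hf : ContMDiffAt I I' ∞ f x) (hg : ContMDiffAt I I'' ∞ g x) :
    modelDeriv I (I'.prod I'') (fun z => (f z, g z)) x =
      (modelDeriv I I' f x).prod (modelDeriv I I'' g x) :=
  MDifferentiableAt.mfderiv_prod (hf.mdifferentiableAt (by simp)) (hg.mdifferentiableAt (by simp))

theorem val_pullback (f : M → M') (om : TwoForm I' M') (p : M) (v w : E) :
    (pullback I I' f om).val p v w =
      om.val (f p) (modelDeriv I I' f p v) (modelDeriv I I' f p w) := by
  unfold TwoForm.val pullback modelDeriv
  rw [ContinuousAlternatingMap.compContinuousLinearMap_apply]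
  congr 1
  funext i
  fin_cases i <;> rfl

theorem TwoForm.val_add_left (om : TwoForm I M) (p : M) (u v w : E) :
    om.val p (u + v) w = om.val p u w + om.val p v w := by
  exact ContinuousAlternatingMap.cons_add (om p : E [⋀^Fin 2]→L[ℝ] ℝ) ![w] u v

theorem TwoForm.val_smul_left (om : TwoForm I M) (p : M) (c : ℝ) (v w : E) :
    om.val p (c • v) w = c * om.val p v w := by
  exact ContinuousAlternatingMap.cons_smul (om p : E [⋀^Fin 2]→L[ℝ] ℝ) ![w] c v

theorem TwoForm.val_swap (om : TwoForm I M) (p : M) (v w : E) :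
    om.val p w v = - om.val p v w := by
  have h := (om p).map_swap (v := ![v, w]) (i := (0 : Fin 2)) (j := 1) (by decide)
  have e : ![v, w] ∘ (Equiv.swap (0 : Fin 2) 1) = ![w, v] := by
    funext i; fin_cases i <;> rfl
  exact (congrArg (om p) e).symm.trans h

/-- The value of a two-form at a point, as a bilinear form on the model vector space. -/
def TwoForm.bilin (om : TwoForm I M) (p : M) : LinearMap.BilinForm ℝ E :=
  LinearMap.mk₂ ℝ (om.val p) (om.val_add_left p) (om.val_smul_left p)
    (fun u v w => by
      rw [om.val_swap p (v + w), om.val_add_left, om.val_swap p v, om.val_swap p w]; ring)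
    (fun c v w => by rw [om.val_swap p (c • w), om.val_smul_left, om.val_swap p w, smul_eq_mul]; ring)

@[simp] theorem TwoForm.bilin_apply (om : TwoForm I M) (p : M) (v w : E) :
    om.bilin p v w = om.val p v w := rfl

theorem TwoForm.bilin_isAlt (om : TwoForm I M) (p : M) : (om.bilin p).IsAlt := fun v => by
  have h := om.val_swap p v v
  rw [om.bilin_apply]; linarith

theorem TwoForm.eq_zero_iff (om : TwoForm I M) : om = 0 ↔ ∀ p v w, om.val p v w = 0 := by
  refine ⟨fun h p v w => by rw [h]; rfl, fun h => ?_⟩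
  funext p
  ext v
  refine Eq.trans (congrArg (om p) ?_) (h p (v 0) (v 1))
  funext i; fin_cases i <;> rfl

theorem TwoForm.ext_val {om om' : TwoForm I M} (h : ∀ p v w, om.val p v w = om'.val p v w) :
    om = om' := by
  funext p
  ext v
  have e : v = ![v 0, v 1] := by funext i; fin_cases i <;> rfl
  rw [e]
  exact h p (v 0) (v 1)

/-- The derivative at `e₀` of a smooth map with values in `S` takes values in the tangent space
of `S`. -/
theorem modelDeriv_mem_tangentSet {f : E → M'} {e₀ : E} {S : Set M'}
    (hf : ContMDiffAt 𝓘(ℝ, E) I' ∞ f e₀) (hS : ∀ᶠ e in 𝓝 e₀, f e ∈ S) (v : E) :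
    modelDeriv 𝓘(ℝ, E) I' f e₀ v ∈ (tangentSet I' S (f e₀) : Set E') := by
  have hl : ContDiff ℝ ∞ (fun t : ℝ => e₀ + t • v) := by fun_prop
  have hl0 : (fun t : ℝ => e₀ + t • v) 0 = e₀ := by simp
  have hd : modelDeriv 𝓘(ℝ, ℝ) 𝓘(ℝ, E) (fun t : ℝ => e₀ + t • v) 0 1 = v := by
    rw [modelDeriv_eq_fderiv]
    have : HasDerivAt (fun t : ℝ => e₀ + t • v) ((1 : ℝ) • v) 0 :=
      ((hasDerivAt_id (0 : ℝ)).smul_const v).const_add e₀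
    rw [fderiv_apply_one_eq_deriv, this.deriv, one_smul]
  refine ⟨f ∘ fun t : ℝ => e₀ + t • v, hf.comp_of_eq hl.contMDiff.contMDiffAt hl0, ?_, ?_⟩
  · have := hl.continuous.tendsto 0
    rw [show e₀ + (0 : ℝ) • v = e₀ by simp] at this
    exact this.eventually hS
  · have h1 : modelDeriv 𝓘(ℝ, ℝ) I' (f ∘ fun t : ℝ => e₀ + t • v) 0 1 =
        modelDeriv 𝓘(ℝ, E) I' f e₀ v := by
      rw [modelDeriv_comp_apply hf hl.contMDiff.contMDiffAt hl0, hd]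
    have h2 : (f ∘ fun t : ℝ => e₀ + t • v) 0 = f e₀ := congrArg f hl0
    -- The two base points are equal but not definitionally so; `key` allows their vectors to be
    -- compared in the common model space.
    have key : ∀ (p q : M') (a b : E'), p = q → a = b →
        (⟨p, a⟩ : TangentBundle I' M') = ⟨q, b⟩ := by
      rintro p q a b rfl rfl; rfl
    exact key _ _ _ _ h2 h1

/-- A tangent vector to `S` is fixed by the derivative of every smooth map that restricts to the
identity on `S`. -/
theorem modelDeriv_apply_of_mem_tangentSet {S : Set M} {ρ : M → M} {p : M}
    (hρ : ContMDiffAt I I ∞ ρ p) (hS : ∀ q ∈ S, ρ q = q) {v : E}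
    (hv : v ∈ (tangentSet I S p : Set E)) : modelDeriv I I ρ p v = v := by
  obtain ⟨c, hc, hcS, hcv⟩ := hv
  have key : ∀ (p q : M) (a b : E), (⟨p, a⟩ : TangentBundle I M) = ⟨q, b⟩ → p = q ∧ a = b := by
    intro p q a b h
    cases h
    exact ⟨rfl, rfl⟩
  obtain ⟨h0, h1⟩ := key _ _ _ _ hcv
  change modelDeriv 𝓘(ℝ, ℝ) I c 0 1 = v at h1
  rw [← h1, ← modelDeriv_comp_apply hρ hc h0]
  exact DFunLike.congr_fun (modelDeriv_congr (hcS.mono fun t ht => hS _ ht)) _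

/-- The vector `v` with `ω(v, ·) = α`, in the model vector space. -/
def TwoForm.dualVector (om : TwoForm I M) (p : M) (α : E →L[ℝ] ℝ) : E := sharp om p α

/-- Non-degeneracy makes `v ↦ ω(v, ·)` injective from `E` to its dual, hence surjective by equality
of dimensions; so `sharp` never falls back on its default value `0` here. -/
theorem TwoForm.val_dualVector [FiniteDimensional ℝ E] {om : TwoForm I M} {p : M}
    (hom : ∀ v, (∀ w, om.val p v w = 0) → v = 0) (α : E →L[ℝ] ℝ) (w : E) :
    om.val p (om.dualVector p α) w = α w := by
  have hinj : Function.Injective (om.bilin p) := by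
    rw [injective_iff_map_eq_zero]
    exact fun v hv => hom v fun w => DFunLike.congr_fun hv w
  have hsurj : Function.Surjective (om.bilin p) :=
    (LinearMap.injective_iff_surjective_of_finrank_eq_finrank
      (Subspace.dual_finrank_eq (K := ℝ) (V := E)).symm).1 hinj
  obtain ⟨v, hv⟩ := hsurj α.toLinearMap
  have h : ∃ v : TangentSpace I p, ∀ w : TangentSpace I p, om p ![v, w] = α w :=
    ⟨v, fun w => DFunLike.congr_fun hv w⟩
  have hs : om.dualVector p α = h.choose := dif_pos h
  exact (congrArg (om.val p · w) hs).trans (h.choose_spec w)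

end Derivatives

/-! ### Block matrices and isotropic subspaces -/

section LinearAlgebra

/-- The second equation gives `a = (ΦΞ - 1)Γ⁻ᵀ`; substituted in the first it becomes `(1 - ΦΞ)N =
Φ`. Hence `(1 - ΦΞ)(1 + NΞ) = 1`, so `1 + NΞ` is invertible with inverse `1 - ΦΞ`, and both formulas
follow. -/
theorem isUnit_and_schur_of_block_inverse {n : ℕ} {F Γ Ξ Φ a : Matrix (Fin n) (Fin n) ℝ}
    (hΓ : IsUnit Γ) (h₁ : a * F + Φ * Γ = 0) (h₂ : Φ * Ξ - a * Γᵀ = 1)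
    {N K : Matrix (Fin n) (Fin n) ℝ} (hN : N = (Γ⁻¹)ᵀ * F * Γ⁻¹) (hK : K = Γᵀ * Φ * Γ) :
    IsUnit (1 + N * Ξ) ∧ Φ = (1 + N * Ξ)⁻¹ * N ∧
      IsUnit (1 - K * (Γ⁻¹ * Ξ * (Γ⁻¹)ᵀ)) ∧ F = (1 - K * (Γ⁻¹ * Ξ * (Γ⁻¹)ᵀ))⁻¹ * K := by
  have hdet : IsUnit Γ.det := (Matrix.isUnit_iff_isUnit_det _).1 hΓ
  obtain ⟨Λ, hΛ⟩ : ∃ Λ, Λ = Γ⁻¹ := ⟨_, rfl⟩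
  have l1 : Λ * Γ = 1 := by rw [hΛ, Matrix.nonsing_inv_mul _ hdet]
  have l2 : Γ * Λ = 1 := by rw [hΛ, Matrix.mul_nonsing_inv _ hdet]
  have t1 : Γᵀ * Λᵀ = 1 := by rw [← Matrix.transpose_mul, l1, Matrix.transpose_one]
  have t2 : Λᵀ * Γᵀ = 1 := by rw [← Matrix.transpose_mul, l2, Matrix.transpose_one]
  rw [← hΛ] at hN ⊢
  have ha : a = (Φ * Ξ - 1) * Λᵀ := by
    rw [← h₂]
    calc a = a * (Γᵀ * Λᵀ) := by rw [t1, mul_one]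
      _ = _ := by noncomm_ring
  have hF : F = Γᵀ * N * Γ := by
    calc F = (Γᵀ * Λᵀ) * F * (Λ * Γ) := by rw [t1, l1, one_mul, mul_one]
      _ = _ := by rw [hN]; noncomm_ring
  have hΦ : (1 - Φ * Ξ) * N = Φ := by
    have h3 : a * F * Λ + Φ * (Γ * Λ) = 0 := by
      calc a * F * Λ + Φ * (Γ * Λ) = (a * F + Φ * Γ) * Λ := by noncomm_ring
        _ = 0 := by rw [h₁, zero_mul]
    rw [l2, mul_one, ha] at h3
    have h4 : (Φ * Ξ - 1) * Λᵀ * F * Λ = (Φ * Ξ - 1) * N := by rw [hN]; noncomm_ring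
    rw [h4] at h3
    calc (1 - Φ * Ξ) * N = Φ - ((Φ * Ξ - 1) * N + Φ) := by noncomm_ring
      _ = Φ := by rw [h3, sub_zero]
  have hi : (1 - Φ * Ξ) * (1 + N * Ξ) = 1 := by
    calc (1 - Φ * Ξ) * (1 + N * Ξ) = 1 - Φ * Ξ + (1 - Φ * Ξ) * N * Ξ := by noncomm_ring
      _ = 1 := by rw [hΦ]; noncomm_ring
  have hi' : (1 + N * Ξ) * (1 - Φ * Ξ) = 1 := mul_eq_one_comm.1 hi
  -- The second matrix to invert is the conjugate of `1 - ΦΞ` by `Γᵀ`.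
  have hD : 1 - K * (Λ * Ξ * Λᵀ) = Γᵀ * (1 - Φ * Ξ) * Λᵀ := by
    calc 1 - K * (Λ * Ξ * Λᵀ) = Γᵀ * Λᵀ - Γᵀ * Φ * (Γ * Λ) * Ξ * Λᵀ := by
          rw [t1, hK]; noncomm_ring
      _ = _ := by rw [l2]; noncomm_ring
  have hj : (Γᵀ * (1 + N * Ξ) * Λᵀ) * (1 - K * (Λ * Ξ * Λᵀ)) = 1 := by
    calc _ = Γᵀ * (1 + N * Ξ) * (Λᵀ * Γᵀ) * (1 - Φ * Ξ) * Λᵀ := by rw [hD]; noncomm_ring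
      _ = Γᵀ * ((1 + N * Ξ) * (1 - Φ * Ξ)) * Λᵀ := by rw [t2]; noncomm_ring
      _ = 1 := by rw [hi', mul_one, t1]
  have hj' := mul_eq_one_comm.1 hj
  refine ⟨⟨⟨_, _, hi', hi⟩, rfl⟩, ?_, ⟨⟨_, _, hj', hj⟩, rfl⟩, ?_⟩
  · rw [Matrix.inv_eq_left_inv hi, hΦ]
  · rw [Matrix.inv_eq_left_inv hj]
    calc F = Γᵀ * N * Γ := hF
      _ = Γᵀ * (((1 + N * Ξ) * (1 - Φ * Ξ)) * N) * Γ := by rw [hi', one_mul]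
      _ = Γᵀ * ((1 + N * Ξ) * ((1 - Φ * Ξ) * N)) * Γ := by noncomm_ring
      _ = Γᵀ * (1 + N * Ξ) * 1 * Φ * Γ := by rw [hΦ]; noncomm_ring
      _ = Γᵀ * (1 + N * Ξ) * (Λᵀ * Γᵀ) * Φ * Γ := by rw [t2]
      _ = _ := by rw [hK]; noncomm_ring

/-- An isotropic subspace of half the dimension equals its own orthogonal. -/
theorem mem_iff_forall_eq_zero_of_isotropic {V : Type*} [AddCommGroup V] [Module ℝ V]
    [FiniteDimensional ℝ V] {B : LinearMap.BilinForm ℝ V} (hB : B.IsAlt)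
    (hnd : ∀ v, (∀ w, B v w = 0) → v = 0) {L : Submodule ℝ V}
    (hL : ∀ v ∈ L, ∀ w ∈ L, B v w = 0)
    (hdim : Module.finrank ℝ V = 2 * Module.finrank ℝ L) (v : V) :
    v ∈ L ↔ ∀ w ∈ L, B v w = 0 := by
  have hneg : ∀ v w, B v w = - B w v := fun v w => (LinearMap.IsAlt.neg hB w v).symm
  have hB' : B.Nondegenerate :=
    ⟨hnd, fun v hv => hnd v fun w => by rw [hneg, hv, neg_zero]⟩
  have hle : L ≤ B.orthogonal L := fun v hv w hw => hL w hw v hv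
  have heq : L = B.orthogonal L := by
    apply Submodule.eq_of_le_of_finrank_eq hle
    rw [LinearMap.BilinForm.finrank_orthogonal hB']
    omega
  refine ⟨hL v, fun h => ?_⟩
  rw [heq]
  intro w hw
  change B w v = 0
  rw [hneg, h w hw, neg_zero]

section Blocks

variable {n : ℕ} {A B : LinearMap.BilinForm ℝ (EuclideanSpace ℝ (Fin n) × EuclideanSpace ℝ (Fin n))}

theorem eq_sum_single_add_sum_single (v : EuclideanSpace ℝ (Fin n) × EuclideanSpace ℝ (Fin n)) :
    v = ∑ l, v.1 l • (EuclideanSpace.single l (1 : ℝ), (0 : EuclideanSpace ℝ (Fin n))) +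
      ∑ k, v.2 k • ((0 : EuclideanSpace ℝ (Fin n)), EuclideanSpace.single k (1 : ℝ)) := by
  have h : ∀ u : EuclideanSpace ℝ (Fin n), u = ∑ l, u l • EuclideanSpace.single l (1 : ℝ) :=
    fun u => by simpa using ((EuclideanSpace.basisFun (Fin n) ℝ).sum_repr u).symm
  refine Prod.ext ?_ ?_
  · simpa [Prod.fst_sum] using h v.1
  · simpa [Prod.snd_sum] using h v.2

theorem bilin_eq_sum (v w : EuclideanSpace ℝ (Fin n) × EuclideanSpace ℝ (Fin n)) :
    A v w = ∑ l, v.1 l * A (EuclideanSpace.single l (1 : ℝ), 0) w +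
      ∑ k, v.2 k * A (0, EuclideanSpace.single k (1 : ℝ)) w := by
  conv_lhs => rw [eq_sum_single_add_sum_single v]
  simp only [map_add, map_sum, map_smul, LinearMap.add_apply, LinearMap.sum_apply,
    LinearMap.smul_apply, smul_eq_mul]

/-- If the first summand is isotropic for a non-degenerate alternating form, the block of the form
that pairs the two summands is invertible. -/
theorem isUnit_of_isotropic_of_nondegenerate (hB : B.IsAlt)
    (hnd : ∀ v, (∀ w, B v w = 0) → v = 0) (h₀ : ∀ e e', B (e, 0) (e', 0) = 0)
    {Γ : Matrix (Fin n) (Fin n) ℝ}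
    (hΓ : ∀ m l, Γ m l = B (0, EuclideanSpace.single m (1 : ℝ))
      (EuclideanSpace.single l (1 : ℝ), 0)) : IsUnit Γ := by
  have hneg : ∀ v w, B v w = - B w v := fun v w => (LinearMap.IsAlt.neg hB w v).symm
  rw [← Matrix.mulVec_injective_iff_isUnit]
  refine (injective_iff_map_eq_zero (Matrix.mulVecLin Γ)).2 fun u hu => ?_
  -- For `u` in the kernel of `Γ`, the vector `(u, 0)` is orthogonal to the first summand by
  -- isotropy and to the second by `Γu = 0`.
  have hU : ((WithLp.toLp 2 u : EuclideanSpace ℝ (Fin n)), (0 : EuclideanSpace ℝ (Fin n))) = 0 := by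
    refine hnd _ fun w => ?_
    rw [hneg, bilin_eq_sum]
    have h1 : ∀ k, B (0, EuclideanSpace.single k (1 : ℝ)) (WithLp.toLp 2 u, 0) = 0 := by
      intro k
      rw [hneg, bilin_eq_sum]
      have := congrFun hu k
      simp only [Matrix.mulVecLin_apply, Matrix.mulVec, dotProduct, Pi.zero_apply] at this
      have h2 : ∑ l, u l * B (EuclideanSpace.single l (1 : ℝ), 0)
          (0, EuclideanSpace.single k (1 : ℝ)) = 0 := by
        rw [← neg_eq_zero, ← Finset.sum_neg_distrib, ← this]
        refine Finset.sum_congr rfl fun l _ => ?_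
        rw [hΓ, hneg]; ring
      simp [h2]
    simp [h₀, h1]
  funext i
  exact congrArg (fun v : EuclideanSpace ℝ (Fin n) => v i) (Prod.ext_iff.1 hU).1

/-- The block equations satisfied by the vectors that represent the coordinates of the second
summand. -/
theorem block_equations (hA : A.IsAlt) {F Γ Ξ Φ a : Matrix (Fin n) (Fin n) ℝ}
    (hF : ∀ l m, F l m = A (EuclideanSpace.single l (1 : ℝ), 0) (EuclideanSpace.single m (1 : ℝ), 0))
    (hΓ : ∀ m l, Γ m l = A (0, EuclideanSpace.single m (1 : ℝ))
      (EuclideanSpace.single l (1 : ℝ), 0))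
    (hΞ : ∀ l m, Ξ l m = A (0, EuclideanSpace.single l (1 : ℝ)) (0, EuclideanSpace.single m (1 : ℝ)))
    {Z : Fin n → EuclideanSpace ℝ (Fin n) × EuclideanSpace ℝ (Fin n)}
    (hZ : ∀ j w, A (Z j) w = w.2 j) (ha : ∀ j l, a j l = (Z j).1 l)
    (hΦ : ∀ j k, Φ j k = (Z j).2 k) : a * F + Φ * Γ = 0 ∧ Φ * Ξ - a * Γᵀ = 1 := by
  have hneg : ∀ v w, A v w = - A w v := fun v w => (LinearMap.IsAlt.neg hA w v).symm
  -- The functional `A (Z j)` is evaluated on the basis of each summand. The sign of `aΓᵀ` arises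
  -- because `Γ` pairs the second summand with the first, in that order.
  constructor
  · ext j m
    have h := hZ j (EuclideanSpace.single m (1 : ℝ), 0)
    rw [bilin_eq_sum] at h
    simpa [Matrix.mul_apply, ha, hΦ, hF, hΓ] using h
  · ext j m
    have h := hZ j (0, EuclideanSpace.single m (1 : ℝ))
    rw [bilin_eq_sum] at h
    simp only [hneg (EuclideanSpace.single _ (1 : ℝ), 0) (0, _), mul_neg,
      Finset.sum_neg_distrib] at h
    simp only [Matrix.sub_apply, Matrix.mul_apply, Matrix.transpose_apply, ha, hΦ, hΓ, hΞ,
      Matrix.one_apply]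
    rw [sub_eq_neg_add, h]
    simp

end Blocks

end LinearAlgebra

/-! ### Products of smooth families and multiplicativity of the form -/

section Groupoid

variable {n d : ℕ} {G X : Type*}
  [TopologicalSpace G] [ChartedSpace (EuclideanSpace ℝ (Fin d)) G]
  [TopologicalSpace X] [ChartedSpace (EuclideanSpace ℝ (Fin n)) X]
  {E : Type*} [NormedAddCommGroup E] [NormedSpace ℝ E] {H : Type*} [TopologicalSpace H]
  {I : ModelWithCorners ℝ E H} {M : Type*} [TopologicalSpace M] [ChartedSpace H M]

namespace LocalLieGroupoid

variable (𝒢 : LocalLieGroupoid n d G X)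

theorem src_inv (α : G) : 𝒢.src (𝒢.inv α) = 𝒢.tgt α := by
  obtain ⟨U, -, hU⟩ := 𝒢.dom_open
  have := (𝒢.inv_dom α).2
  rw [hU] at this
  exact this.2

theorem tgt_inv (α : G) : 𝒢.tgt (𝒢.inv α) = 𝒢.src α := by
  obtain ⟨U, -, hU⟩ := 𝒢.dom_open
  have := (𝒢.inv_dom α).1
  rw [hU] at this
  exact this.2.symm

/-- The domain is open only relative to the matching condition, so that condition is required
nearby; openness then spreads membership from `e₀`. -/
theorem eventually_mem_dom {M : Type*} [TopologicalSpace M] {f h : M → G} {e₀ : M}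
    (hf : ContinuousAt f e₀) (hh : ContinuousAt h e₀)
    (hc : ∀ᶠ e in 𝓝 e₀, 𝒢.src (f e) = 𝒢.tgt (h e)) (h₀ : (f e₀, h e₀) ∈ 𝒢.dom) :
    ∀ᶠ e in 𝓝 e₀, (f e, h e) ∈ 𝒢.dom := by
  obtain ⟨U, hUo, hU⟩ := 𝒢.dom_open
  rw [hU] at h₀ ⊢
  filter_upwards [hc, (hf.prodMk hh).eventually (hUo.mem_nhds h₀.1)] with e h1 h2
  exact ⟨h2, h1⟩

theorem contMDiffAt_mul {f h : M → G} {e₀ : M}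
    (hf : ContMDiffAt I (𝓡 d) ∞ f e₀) (hh : ContMDiffAt I (𝓡 d) ∞ h e₀)
    (hdom : ∀ᶠ e in 𝓝 e₀, (f e, h e) ∈ 𝒢.dom) :
    ContMDiffAt I (𝓡 d) ∞ (fun e => 𝒢.mul (f e, h e)) e₀ := by
  have h1 : ContMDiffWithinAt I ((𝓡 d).prod (𝓡 d)) ∞ (fun e => (f e, h e))
      {e | (f e, h e) ∈ 𝒢.dom} e₀ := (hf.prodMk hh).contMDiffWithinAt
  exact ((𝒢.mul_smooth _ hdom.self_of_nhds).comp e₀ h1 fun e he => he).contMDiffAt hdom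

end LocalLieGroupoid

theorem LocalSymplecticGroupoid.val_nondegenerate (𝒢 : LocalSymplecticGroupoid n d G X) (g : G)
    (v : EuclideanSpace ℝ (Fin d)) (h : ∀ w, 𝒢.om.val g v w = 0) : v = 0 :=
  𝒢.symplectic.nondegenerate g v h

theorem val_tripleForm (om : TwoForm (𝓡 d) G) (q : G × G × G)
    (v w : EuclideanSpace ℝ (Fin d) × EuclideanSpace ℝ (Fin d) × EuclideanSpace ℝ (Fin d)) :
    (tripleForm om).val q v w =
      - om.val q.1 v.1 w.1 + om.val q.2.1 v.2.1 w.2.1 + om.val q.2.2 v.2.2 w.2.2 := by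
  have h2 : modelDeriv ((𝓡 d).prod ((𝓡 d).prod (𝓡 d))) (𝓡 d) (fun q : G × G × G => q.2.1) q =
      (ContinuousLinearMap.fst ℝ _ _).comp (ContinuousLinearMap.snd ℝ _ _) :=
    (modelDeriv_comp (g := fun q : G × G => q.1) (f := fun q : G × G × G => q.2)
      (I' := (𝓡 d).prod (𝓡 d)) contMDiffAt_fst contMDiffAt_snd rfl).trans
      (congrArg₂ ContinuousLinearMap.comp mfderiv_fst mfderiv_snd)
  have h3 : modelDeriv ((𝓡 d).prod ((𝓡 d).prod (𝓡 d))) (𝓡 d) (fun q : G × G × G => q.2.2) q =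
      (ContinuousLinearMap.snd ℝ _ _).comp (ContinuousLinearMap.snd ℝ _ _) :=
    (modelDeriv_comp (g := fun q : G × G => q.2) (f := fun q : G × G × G => q.2)
      (I' := (𝓡 d).prod (𝓡 d)) contMDiffAt_snd contMDiffAt_snd rfl).trans
      (congrArg₂ ContinuousLinearMap.comp mfderiv_snd mfderiv_snd)
  have h1 : modelDeriv ((𝓡 d).prod ((𝓡 d).prod (𝓡 d))) (𝓡 d) (fun q : G × G × G => q.1) q =
      ContinuousLinearMap.fst ℝ _ _ := mfderiv_fst
  have e1 := val_pullback (I := (𝓡 d).prod ((𝓡 d).prod (𝓡 d))) (fun q : G × G × G => q.1) om q v w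
  have e2 := val_pullback (I := (𝓡 d).prod ((𝓡 d).prod (𝓡 d))) (fun q : G × G × G => q.2.1) om q v w
  have e3 := val_pullback (I := (𝓡 d).prod ((𝓡 d).prod (𝓡 d))) (fun q : G × G × G => q.2.2) om q v w
  rw [h1] at e1
  rw [h2] at e2
  rw [h3] at e3
  exact congrArg₂ (· + ·) (congrArg₂ (· + ·) (congrArg Neg.neg e1) e2) e3

/-- The symplectic form is multiplicative. -/
theorem LocalSymplecticGroupoid.val_mul (𝒢 : LocalSymplecticGroupoid n d G X) {f h : E → G} {e₀ : E}
    (hf : ContMDiffAt 𝓘(ℝ, E) (𝓡 d) ∞ f e₀) (hh : ContMDiffAt 𝓘(ℝ, E) (𝓡 d) ∞ h e₀)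
    (hdom : ∀ᶠ e in 𝓝 e₀, (f e, h e) ∈ 𝒢.dom) {k : E → G}
    (hk : ∀ᶠ e in 𝓝 e₀, 𝒢.mul (f e, h e) = k e) (v w : E) :
    𝒢.om.val (k e₀) (modelDeriv 𝓘(ℝ, E) (𝓡 d) k e₀ v) (modelDeriv 𝓘(ℝ, E) (𝓡 d) k e₀ w) =
      𝒢.om.val (f e₀) (modelDeriv 𝓘(ℝ, E) (𝓡 d) f e₀ v) (modelDeriv 𝓘(ℝ, E) (𝓡 d) f e₀ w) +
      𝒢.om.val (h e₀) (modelDeriv 𝓘(ℝ, E) (𝓡 d) h e₀ v) (modelDeriv 𝓘(ℝ, E) (𝓡 d) h e₀ w) := by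
  have hks : ContMDiffAt 𝓘(ℝ, E) (𝓡 d) ∞ k e₀ :=
    (𝒢.contMDiffAt_mul hf hh hdom).congr_of_eventuallyEq (hk.mono fun e he => he.symm)
  have hgr : ∀ᶠ e in 𝓝 e₀, (k e, f e, h e) ∈
      {q : G × G × G | (q.2.1, q.2.2) ∈ 𝒢.dom ∧ q.1 = 𝒢.mul (q.2.1, q.2.2)} := by
    filter_upwards [hdom, hk] with e h1 h2 using ⟨h1, h2.symm⟩
  -- The family `(k, f, h)` runs in the graph, so its velocities are tangent to the graph, where the
  -- triple form vanishes.
  have hmem := modelDeriv_mem_tangentSet (hks.prodMk (hf.prodMk hh)) hgr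
  have h0 := (𝒢.graph_lagrangian.2 _ hgr.self_of_nhds _).1 (hmem v) _ (hmem w)
  have h1 := val_tripleForm 𝒢.om (k e₀, f e₀, h e₀)
    (modelDeriv 𝓘(ℝ, E) ((𝓡 d).prod ((𝓡 d).prod (𝓡 d))) (fun e => (k e, f e, h e)) e₀ v)
    (modelDeriv 𝓘(ℝ, E) ((𝓡 d).prod ((𝓡 d).prod (𝓡 d))) (fun e => (k e, f e, h e)) e₀ w)
  rw [show TwoForm.val (tripleForm 𝒢.om) _ _ _ = 0 from h0,
    modelDeriv_prodMk hks (hf.prodMk hh), modelDeriv_prodMk hf hh] at h1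
  simp only [ContinuousLinearMap.prod_apply] at h1
  linarith

end Groupoid

/-! ### Bisections, their right actions and their tangent spaces -/

section Bisections

variable {n d : ℕ} {G X : Type*}
  [TopologicalSpace G] [ChartedSpace (EuclideanSpace ℝ (Fin d)) G]
  [TopologicalSpace X] [ChartedSpace (EuclideanSpace ℝ (Fin n)) X]
  {𝒢 : LocalSymplecticGroupoid n d G X}

namespace Bisection

variable (S : Bisection 𝒢)

theorem srcSec_r (y : X) : S.srcSec (S.r y) = S.tgtSec y :=
  S.srcSec_src _ (S.tgtSec_mem y)

theorem tgtSec_l (x : X) : S.tgtSec (S.l x) = S.srcSec x :=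
  S.tgtSec_tgt _ (S.srcSec_mem x)

theorem l_r (y : X) : S.l (S.r y) = y := by
  rw [l, srcSec_r, S.tgt_tgtSec]

theorem R_unit (y : X) : S.R (𝒢.unit y) = S.tgtSec y := by
  have h := 𝒢.unit_mul (S.tgtSec y)
  rw [S.tgt_tgtSec] at h
  rw [R, 𝒢.src_unit, h]

theorem RInv_tgtSec (y : X) : S.RInv (S.tgtSec y) = 𝒢.unit y := by
  rw [RInv, S.srcSec_src _ (S.tgtSec_mem y), 𝒢.mul_inv, S.tgt_tgtSec]

theorem contMDiff_l : ContMDiff (𝓡 n) (𝓡 n) ∞ S.l :=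
  𝒢.tgt_submersion.contMDiff.comp S.srcSec_smooth

theorem contMDiff_r : ContMDiff (𝓡 n) (𝓡 n) ∞ S.r :=
  𝒢.src_submersion.contMDiff.comp S.tgtSec_smooth

theorem Ft_eq_pullback : S.Ft = pullback (𝓡 n) (𝓡 n) S.r S.Fs := by
  refine TwoForm.ext_val fun p v w => ?_
  have h : S.srcSec ∘ S.r = S.tgtSec := funext S.srcSec_r
  rw [Ft, Fs, val_pullback, val_pullback, val_pullback,
    ← modelDeriv_comp_apply S.srcSec_smooth.contMDiffAt S.contMDiff_r.contMDiffAt rfl,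
    ← modelDeriv_comp_apply S.srcSec_smooth.contMDiffAt S.contMDiff_r.contMDiffAt rfl,
    h, srcSec_r]

theorem Fs_eq_pullback : S.Fs = pullback (𝓡 n) (𝓡 n) S.l S.Ft := by
  refine TwoForm.ext_val fun p v w => ?_
  have h : S.tgtSec ∘ S.l = S.srcSec := funext S.tgtSec_l
  rw [Ft, Fs, val_pullback, val_pullback, val_pullback,
    ← modelDeriv_comp_apply S.tgtSec_smooth.contMDiffAt S.contMDiff_l.contMDiffAt rfl,
    ← modelDeriv_comp_apply S.tgtSec_smooth.contMDiffAt S.contMDiff_l.contMDiffAt rfl,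
    h, tgtSec_l]

theorem Fs_eq_zero_iff_Ft_eq_zero : S.Fs = 0 ↔ S.Ft = 0 := by
  constructor <;> intro h
  · rw [S.Ft_eq_pullback, TwoForm.eq_zero_iff]
    intro p v w
    rw [val_pullback, h]; rfl
  · rw [S.Fs_eq_pullback, TwoForm.eq_zero_iff]
    intro p v w
    rw [val_pullback, h]; rfl

theorem eventually_R_dom (y : X) :
    ∀ᶠ g in 𝓝 (𝒢.unit y), (g, S.tgtSec (𝒢.src g)) ∈ 𝒢.dom := by
  refine 𝒢.eventually_mem_dom continuousAt_id
    (S.tgtSec_smooth.comp 𝒢.src_submersion.contMDiff).continuous.continuousAt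
    (.of_forall fun g => (S.tgt_tgtSec _).symm) ?_
  have h := (𝒢.unit_dom (S.tgtSec y)).2
  rw [S.tgt_tgtSec] at h
  simpa [𝒢.src_unit] using h

theorem contMDiffAt_R (y : X) : ContMDiffAt (𝓡 d) (𝓡 d) ∞ S.R (𝒢.unit y) :=
  𝒢.contMDiffAt_mul contMDiffAt_id (S.tgtSec_smooth.comp 𝒢.src_submersion.contMDiff).contMDiffAt
    (S.eventually_R_dom y)

theorem contMDiff_inv_srcSec_src :
    ContMDiff (𝓡 d) (𝓡 d) ∞ fun g => 𝒢.inv (S.srcSec (𝒢.src g)) :=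
  𝒢.inv.contMDiff.comp (S.srcSec_smooth.comp 𝒢.src_submersion.contMDiff)

theorem eventually_RInv_dom (y : X) :
    ∀ᶠ g in 𝓝 (S.tgtSec y), (g, 𝒢.inv (S.srcSec (𝒢.src g))) ∈ 𝒢.dom := by
  refine 𝒢.eventually_mem_dom continuousAt_id S.contMDiff_inv_srcSec_src.continuous.continuousAt
    (.of_forall fun g => ?_) ?_
  · rw [𝒢.tgt_inv, S.src_srcSec]
  · rw [S.srcSec_src _ (S.tgtSec_mem y)]
    exact (𝒢.inv_dom _).1

theorem contMDiffAt_RInv (y : X) : ContMDiffAt (𝓡 d) (𝓡 d) ∞ S.RInv (S.tgtSec y) :=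
  𝒢.contMDiffAt_mul contMDiffAt_id S.contMDiff_inv_srcSec_src.contMDiffAt
    (S.eventually_RInv_dom y)

/-- This is `(gσ⁻¹)σ = g` with `σ = Σ_s(s(g))`. Local associativity needs all the products involved
to be defined; only that of `gσ⁻¹` with `σ` remains to be checked after `eventually_RInv_dom`, and
at `g = Σ_t(y)` it is the product `1_y·Σ_t(y)`. -/
theorem eventually_R_RInv (y : X) : ∀ᶠ g in 𝓝 (S.tgtSec y), S.R (S.RInv g) = g := by
  have h2 : ∀ᶠ g in 𝓝 (S.tgtSec y), (S.RInv g, S.srcSec (𝒢.src g)) ∈ 𝒢.dom := by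
    refine 𝒢.eventually_mem_dom (S.contMDiffAt_RInv y).continuousAt
      (S.srcSec_smooth.comp 𝒢.src_submersion.contMDiff).continuous.continuousAt ?_ ?_
    · filter_upwards [S.eventually_RInv_dom y] with g h
      rw [RInv, 𝒢.src_mul _ _ h, 𝒢.src_inv]
    · have h := (𝒢.unit_dom (S.tgtSec y)).2
      rw [S.tgt_tgtSec] at h
      rwa [S.RInv_tgtSec, S.srcSec_src _ (S.tgtSec_mem y)]
  filter_upwards [S.eventually_RInv_dom y, h2] with g h1 h2
  have hs : 𝒢.src (S.RInv g) = 𝒢.tgt (S.srcSec (𝒢.src g)) := by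
    rw [RInv, 𝒢.src_mul _ _ h1, 𝒢.src_inv]
  have ha := 𝒢.mul_assoc g (𝒢.inv (S.srcSec (𝒢.src g))) (S.srcSec (𝒢.src g)) h1
    (𝒢.inv_dom _).2 h2
  rw [𝒢.inv_mul, S.src_srcSec] at ha
  rw [R, hs, S.tgtSec_tgt _ (S.srcSec_mem _), RInv, ← ha (𝒢.unit_dom g).1, 𝒢.mul_unit]

theorem eventually_RInv_R (y : X) : ∀ᶠ g in 𝓝 (𝒢.unit y), S.RInv (S.R g) = g := by
  -- At the unit this pair is `Σ_t(y)` with its inverse.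
  have h2 : ∀ᶠ g in 𝓝 (𝒢.unit y), (S.R g, 𝒢.inv (S.tgtSec (𝒢.src g))) ∈ 𝒢.dom := by
    refine 𝒢.eventually_mem_dom (S.contMDiffAt_R y).continuousAt (𝒢.inv.contMDiff.comp
      (S.tgtSec_smooth.comp 𝒢.src_submersion.contMDiff)).continuous.continuousAt ?_ ?_
    · filter_upwards [S.eventually_R_dom y] with g h
      rw [R, 𝒢.src_mul _ _ h, 𝒢.tgt_inv]
    · rw [S.R_unit, 𝒢.src_unit]
      exact (𝒢.inv_dom _).1
  filter_upwards [S.eventually_R_dom y, h2] with g h1 h2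
  have hs : 𝒢.src (S.R g) = 𝒢.src (S.tgtSec (𝒢.src g)) := by
    rw [R, 𝒢.src_mul _ _ h1]
  have ha := 𝒢.mul_assoc g (S.tgtSec (𝒢.src g)) (𝒢.inv (S.tgtSec (𝒢.src g))) h1
    (𝒢.inv_dom _).1 h2
  rw [𝒢.mul_inv, S.tgt_tgtSec] at ha
  rw [RInv, hs, S.srcSec_src _ (S.tgtSec_mem _), R, ← ha (𝒢.unit_dom g).1, 𝒢.mul_unit]

theorem modelDeriv_srcSec_src_apply (x : X) (v : EuclideanSpace ℝ (Fin n)) :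
    modelDeriv (𝓡 d) (𝓡 n) 𝒢.src (S.srcSec x) (modelDeriv (𝓡 n) (𝓡 d) S.srcSec x v) = v :=
  modelDeriv_apply_of_eventually_leftInverse 𝒢.src_submersion.contMDiff.contMDiffAt
    S.srcSec_smooth.contMDiffAt rfl (.of_forall S.src_srcSec) v

/-- The tangent space of a bisection at `Σ_s(x)` is the range of the derivative of `Σ_s`. -/
theorem mem_tangentSet_iff [IsManifold (𝓡 n) ∞ X] (x : X) (v : EuclideanSpace ℝ (Fin d)) :
    v ∈ (tangentSet (𝓡 d) S.carrier (S.srcSec x) : Set (EuclideanSpace ℝ (Fin d))) ↔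
      v ∈ LinearMap.range (modelDeriv (𝓡 n) (𝓡 d) S.srcSec x).toLinearMap := by
  constructor
  · intro hv
    -- The map `Σ_s ∘ s` is the identity on `Σ`, so its derivative fixes every tangent vector of
    -- `Σ`.
    refine ⟨modelDeriv (𝓡 d) (𝓡 n) 𝒢.src (S.srcSec x) v, ?_⟩
    have h := modelDeriv_apply_of_mem_tangentSet
      (S.srcSec_smooth.comp 𝒢.src_submersion.contMDiff).contMDiffAt S.srcSec_src hv
    rw [modelDeriv_comp_apply S.srcSec_smooth.contMDiffAt
      𝒢.src_submersion.contMDiff.contMDiffAt (S.src_srcSec x)] at h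
    exact h
  · rintro ⟨u, rfl⟩
    -- Curves with prescribed velocity are available on a vector space, so `Σ_s` is composed with a
    -- chart of `X`.
    have hx : x ∈ (chartAt (EuclideanSpace ℝ (Fin n)) x).source := mem_chart_source _ x
    have hs : ContMDiffAt (𝓡 n) (𝓡 n) ∞ (chartAt (EuclideanSpace ℝ (Fin n)) x).symm
        (chartAt (EuclideanSpace ℝ (Fin n)) x x) :=
      contMDiffAt_symm_of_mem_maximalAtlas (IsManifold.chart_mem_maximalAtlas x)
        (OpenPartialHomeomorph.map_source _ hx)
    have hc : ContMDiffAt (𝓡 n) (𝓡 n) ∞ (chartAt (EuclideanSpace ℝ (Fin n)) x) x :=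
      contMDiffAt_of_mem_maximalAtlas (IsManifold.chart_mem_maximalAtlas x) hx
    have hinv := OpenPartialHomeomorph.left_inv _ hx
    have hu : modelDeriv (𝓡 n) (𝓡 n) (chartAt (EuclideanSpace ℝ (Fin n)) x).symm
        (chartAt (EuclideanSpace ℝ (Fin n)) x x)
        (modelDeriv (𝓡 n) (𝓡 n) (chartAt (EuclideanSpace ℝ (Fin n)) x) x u) = u :=
      modelDeriv_apply_of_eventually_leftInverse hs hc rfl
        (OpenPartialHomeomorph.eventually_left_inverse _ hx) u
    have h := modelDeriv_mem_tangentSet (S.srcSec_smooth.contMDiffAt.comp _ hs)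
      (S := S.carrier) (.of_forall fun e => S.srcSec_mem _)
      (modelDeriv (𝓡 n) (𝓡 n) (chartAt (EuclideanSpace ℝ (Fin n)) x) x u)
    rw [modelDeriv_comp_apply S.srcSec_smooth.contMDiffAt hs hinv, hu, Function.comp_apply,
      hinv] at h
    exact h

/-- The tangent spaces of `Σ` are the ranges of the injective maps `dΣ_s`, so `F^s = 0` is isotropy
in dimension `n`, half of `d`. The dimension equality is conditional on a point of `X` because it is
read off a momentum chart. -/
theorem Fs_eq_zero_iff_isLagrangian [IsManifold (𝓡 n) ∞ X] (hd : X → d = 2 * n) :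
    S.Fs = 0 ↔ IsLagrangianSubmanifold (𝓡 d) 𝒢.om S.carrier := by
  have hval : ∀ x v w, S.Fs.val x v w = 𝒢.om.val (S.srcSec x)
      (modelDeriv (𝓡 n) (𝓡 d) S.srcSec x v) (modelDeriv (𝓡 n) (𝓡 d) S.srcSec x w) :=
    fun x v w => val_pullback _ _ _ _ _
  rw [TwoForm.eq_zero_iff]
  constructor
  · intro h
    refine ⟨S.embedded, fun p hp => ?_⟩
    obtain ⟨x, rfl⟩ : ∃ x, S.srcSec x = p := ⟨_, S.srcSec_src p hp⟩
    have hinj : Function.Injective (modelDeriv (𝓡 n) (𝓡 d) S.srcSec x).toLinearMap :=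
      Function.LeftInverse.injective (S.modelDeriv_srcSec_src_apply x)
    have key := mem_iff_forall_eq_zero_of_isotropic (𝒢.om.bilin_isAlt (S.srcSec x))
      (𝒢.val_nondegenerate (S.srcSec x))
      (L := LinearMap.range (modelDeriv (𝓡 n) (𝓡 d) S.srcSec x).toLinearMap)
      (by
        rintro _ ⟨v, rfl⟩ _ ⟨w, rfl⟩
        exact (hval x v w).symm.trans (h x v w))
      (by rw [LinearMap.finrank_range_of_inj hinj]; simpa using hd x)
    intro v
    refine (S.mem_tangentSet_iff x v).trans ((key v).trans ?_)
    exact forall_congr' fun w => imp_congr_left (S.mem_tangentSet_iff x w).symm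
  · intro h x v w
    rw [hval]
    exact (h.2 _ (S.srcSec_mem x) _).1 ((S.mem_tangentSet_iff x _).2 ⟨v, rfl⟩) _
      ((S.mem_tangentSet_iff x _).2 ⟨w, rfl⟩)

end Bisection

end Bisections

/-! ### Coordinates around the units -/

section Charts

variable {n d : ℕ} {G X : Type*}
  [TopologicalSpace G] [ChartedSpace (EuclideanSpace ℝ (Fin d)) G]
  [TopologicalSpace X] [ChartedSpace (EuclideanSpace ℝ (Fin n)) X]
  {𝒢 : LocalSymplecticGroupoid n d G X} {y : X}

/-- The space of the coordinates `(x, p)`. -/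
abbrev PhaseSpace (n : ℕ) : Type := EuclideanSpace ℝ (Fin n) × EuclideanSpace ℝ (Fin n)

theorem modelDeriv_comp_inl_apply {E F : Type*} [NormedAddCommGroup E] [NormedSpace ℝ E]
    [NormedAddCommGroup F] [NormedSpace ℝ F]
    {f : E × F → G} {e₀ : E} {z : E × F} (hf : ContMDiffAt 𝓘(ℝ, E × F) (𝓡 d) ∞ f z)
    (hz : (e₀, (0 : F)) = z) (e : E) :
    modelDeriv 𝓘(ℝ, E) (𝓡 d) (f ∘ fun e : E => (e, (0 : F))) e₀ e =
      modelDeriv 𝓘(ℝ, E × F) (𝓡 d) f z (e, 0) := by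
  have h : ContDiff ℝ ∞ (fun e : E => (e, (0 : F))) := by fun_prop
  rw [modelDeriv_comp_apply hf h.contMDiff.contMDiffAt hz, modelDeriv_eq_fderiv]
  congr 1
  exact DFunLike.congr_fun (ContinuousLinearMap.inl ℝ E F).hasFDerivAt.fderiv e

theorem modelDeriv_comp_fst_apply {E F : Type*} [NormedAddCommGroup E] [NormedSpace ℝ E]
    [NormedAddCommGroup F] [NormedSpace ℝ F]
    {f : E → G} {e₀ : E} {z : E × F} (hf : ContMDiffAt 𝓘(ℝ, E) (𝓡 d) ∞ f e₀)
    (hz : z.1 = e₀) (v : E × F) :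
    modelDeriv 𝓘(ℝ, E × F) (𝓡 d) (f ∘ fun v : E × F => v.1) z v =
      modelDeriv 𝓘(ℝ, E) (𝓡 d) f e₀ v.1 := by
  rw [modelDeriv_comp_apply hf contDiff_fst.contMDiff.contMDiffAt hz, modelDeriv_eq_fderiv,
    fderiv_fst]
  rfl

namespace MomentumChart

variable (P : MomentumChart 𝒢 y)

theorem mem_base_source : y ∈ P.base.source := by
  simpa [𝒢.src_unit] using P.src_mem _ P.unit_mem

theorem chart_unit : P.chart (𝒢.unit y) = (P.base y, 0) := by
  refine Prod.ext ?_ ((P.snd_chart _ P.unit_mem).2 (mem_range_self _))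
  rw [P.fst_chart _ P.unit_mem, 𝒢.src_unit]

theorem symm_chart_unit : P.chart.symm (P.chart (𝒢.unit y)) = 𝒢.unit y :=
  P.chart.left_inv P.unit_mem

theorem chart_unit_mem_target : P.chart (𝒢.unit y) ∈ P.chart.target :=
  P.chart.map_source P.unit_mem

theorem contMDiffAt_chart :
    ContMDiffAt (𝓡 d) 𝓘(ℝ, PhaseSpace n) ∞ P.chart (𝒢.unit y) :=
  P.chart_smooth.contMDiffAt (P.chart.open_source.mem_nhds P.unit_mem)

theorem contMDiffAt_chart_symm :
    ContMDiffAt 𝓘(ℝ, PhaseSpace n) (𝓡 d) ∞ P.chart.symm (P.chart (𝒢.unit y)) :=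
  P.chart_symm_smooth.contMDiffAt (P.chart.open_target.mem_nhds P.chart_unit_mem_target)

theorem contMDiffAt_base_symm : ContMDiffAt (𝓡 n) (𝓡 n) ∞ P.base.symm (P.base y) :=
  contMDiffAt_symm_of_mem_maximalAtlas P.base_mem (P.base.map_source P.mem_base_source)

theorem contMDiffAt_base : ContMDiffAt (𝓡 n) (𝓡 n) ∞ P.base y :=
  contMDiffAt_of_mem_maximalAtlas P.base_mem P.mem_base_source

theorem eventually_src_chart_symm :
    ∀ᶠ z in 𝓝 (P.chart (𝒢.unit y)), 𝒢.src (P.chart.symm z) = P.base.symm z.1 := by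
  filter_upwards [P.chart.open_target.mem_nhds P.chart_unit_mem_target] with z hz
  have hs := P.chart.map_target hz
  rw [← P.base.left_inv (P.src_mem _ hs), ← P.fst_chart _ hs, P.chart.right_inv hz]

theorem eventually_chart_symm_eq_unit :
    ∀ᶠ e in 𝓝 (P.base y), P.chart.symm (e, 0) = 𝒢.unit (P.base.symm e) := by
  have h1 : ContinuousAt (fun e => 𝒢.unit (P.base.symm e)) (P.base y) :=
    𝒢.unit_smooth.continuous.continuousAt.comp P.contMDiffAt_base_symm.continuousAt
  have h2 : P.chart.source ∈ 𝓝 (𝒢.unit (P.base.symm (P.base y))) := by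
    rw [P.base.left_inv P.mem_base_source]
    exact P.chart.open_source.mem_nhds P.unit_mem
  filter_upwards [h1.eventually h2, P.base.open_target.mem_nhds
    (P.base.map_source P.mem_base_source)] with e he het
  have h3 : P.chart (𝒢.unit (P.base.symm e)) = (e, 0) := by
    refine Prod.ext ?_ ((P.snd_chart _ he).2 (mem_range_self _))
    rw [P.fst_chart _ he, 𝒢.src_unit, P.base.right_inv het]
  rw [← h3, P.chart.left_inv he]

/-- The derivative of the inverse of the chart. -/
def symmDeriv : PhaseSpace n →L[ℝ] EuclideanSpace ℝ (Fin d) :=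
  modelDeriv 𝓘(ℝ, PhaseSpace n) (𝓡 d) P.chart.symm (P.chart (𝒢.unit y))

theorem symmDeriv_modelDeriv_chart (v : EuclideanSpace ℝ (Fin d)) :
    P.symmDeriv (modelDeriv (𝓡 d) 𝓘(ℝ, PhaseSpace n) P.chart (𝒢.unit y) v) = v :=
  modelDeriv_apply_of_eventually_leftInverse P.contMDiffAt_chart_symm P.contMDiffAt_chart rfl
    (P.chart.eventually_left_inverse P.unit_mem) v

theorem modelDeriv_chart_symmDeriv (v : PhaseSpace n) :
    modelDeriv (𝓡 d) 𝓘(ℝ, PhaseSpace n) P.chart (𝒢.unit y) (P.symmDeriv v) = v :=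
  modelDeriv_apply_of_eventually_leftInverse P.contMDiffAt_chart P.contMDiffAt_chart_symm
    P.symm_chart_unit (P.chart.eventually_right_inverse P.chart_unit_mem_target) v

theorem dim_eq (P : MomentumChart 𝒢 y) : d = 2 * n := by
  have h1 := LinearMap.finrank_le_finrank_of_injective (f := P.symmDeriv.toLinearMap)
    (Function.LeftInverse.injective P.modelDeriv_chart_symmDeriv)
  have h2 := LinearMap.finrank_le_finrank_of_injective
    (f := (modelDeriv (𝓡 d) 𝓘(ℝ, PhaseSpace n) P.chart (𝒢.unit y)).toLinearMap)
    (Function.LeftInverse.injective P.symmDeriv_modelDeriv_chart)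
  simp at h1 h2
  omega

/-- The symplectic form at the unit, in coordinates. -/
def unitForm : LinearMap.BilinForm ℝ (PhaseSpace n) :=
  (𝒢.om.bilin (𝒢.unit y)).comp P.symmDeriv.toLinearMap P.symmDeriv.toLinearMap

theorem unitForm_apply (v w : PhaseSpace n) :
    P.unitForm v w = 𝒢.om.val (𝒢.unit y) (P.symmDeriv v) (P.symmDeriv w) := rfl

theorem unitForm_isAlt : P.unitForm.IsAlt := fun _ => 𝒢.om.bilin_isAlt _ _

theorem unitForm_nondegenerate (v : PhaseSpace n) (h : ∀ w, P.unitForm v w = 0) : v = 0 := by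
  rw [← P.modelDeriv_chart_symmDeriv v, 𝒢.val_nondegenerate (𝒢.unit y) (P.symmDeriv v), map_zero]
  intro w
  rw [← P.symmDeriv_modelDeriv_chart w]
  exact h _

/-- In coordinates the source is the projection to `x`, so maps that factor through it have zero
derivative in the momentum directions. -/
theorem modelDeriv_comp_src_chart_symm_apply {σ : X → G} (hσ : ContMDiff (𝓡 n) (𝓡 d) ∞ σ)
    (v : PhaseSpace n) :
    modelDeriv 𝓘(ℝ, PhaseSpace n) (𝓡 d) (fun z => σ (𝒢.src (P.chart.symm z)))
      (P.chart (𝒢.unit y)) v = modelDeriv (𝓡 n) (𝓡 d) (σ ∘ P.base.symm) (P.base y) v.1 := by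
  have h : (fun z => σ (𝒢.src (P.chart.symm z))) =ᶠ[𝓝 (P.chart (𝒢.unit y))]
      (σ ∘ P.base.symm) ∘ fun v : PhaseSpace n => v.1 :=
    P.eventually_src_chart_symm.mono fun z hz => congrArg σ hz
  rw [modelDeriv_congr h]
  exact modelDeriv_comp_fst_apply (hσ.contMDiffAt.comp _ P.contMDiffAt_base_symm)
    (by rw [P.chart_unit]) v

theorem symmDeriv_inl (e : EuclideanSpace ℝ (Fin n)) :
    P.symmDeriv (e, 0) = modelDeriv (𝓡 n) (𝓡 d) (𝒢.unit ∘ P.base.symm) (P.base y) e := by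
  rw [symmDeriv, ← modelDeriv_comp_inl_apply P.contMDiffAt_chart_symm P.chart_unit.symm]
  exact DFunLike.congr_fun (modelDeriv_congr P.eventually_chart_symm_eq_unit) e

/-- The units are isotropic. -/
theorem unitForm_inl_inl (e e' : EuclideanSpace ℝ (Fin n)) : P.unitForm (e, 0) (e', 0) = 0 := by
  have hu : ContMDiffAt (𝓡 n) (𝓡 d) ∞ (𝒢.unit ∘ P.base.symm) (P.base y) :=
    𝒢.unit_smooth.contMDiffAt.comp _ P.contMDiffAt_base_symm
  -- Multiplicativity applied to `1·1 = 1` reads `ω = ω + ω` on the units.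
  have h := 𝒢.val_mul hu hu (k := 𝒢.unit ∘ P.base.symm)
    (.of_forall fun z => by simpa [𝒢.src_unit] using (𝒢.unit_dom (𝒢.unit (P.base.symm z))).1)
    (.of_forall fun z => by simpa [𝒢.src_unit] using 𝒢.mul_unit (𝒢.unit (P.base.symm z))) e e'
  rw [unitForm_apply, symmDeriv_inl, symmDeriv_inl]
  rw [Function.comp_apply, P.base.left_inv P.mem_base_source] at h
  linarith

end MomentumChart

/-! ### The right action in coordinates and the field strengths -/

namespace Bisection

variable (S : Bisection 𝒢) (P : MomentumChart 𝒢 y)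

theorem contMDiffAt_R_chart_symm :
    ContMDiffAt 𝓘(ℝ, PhaseSpace n) (𝓡 d) ∞ (S.R ∘ P.chart.symm) (P.chart (𝒢.unit y)) :=
  (S.contMDiffAt_R y).comp_of_eq P.contMDiffAt_chart_symm P.symm_chart_unit

theorem contMDiffAt_chart_RInv :
    ContMDiffAt (𝓡 d) 𝓘(ℝ, PhaseSpace n) ∞ (P.chart ∘ S.RInv) (S.tgtSec y) :=
  P.contMDiffAt_chart.comp_of_eq (S.contMDiffAt_RInv y) (S.RInv_tgtSec y)

/-- The derivative of the right action in coordinates. -/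
def RDeriv : PhaseSpace n →L[ℝ] EuclideanSpace ℝ (Fin d) :=
  modelDeriv 𝓘(ℝ, PhaseSpace n) (𝓡 d) (S.R ∘ P.chart.symm) (P.chart (𝒢.unit y))

/-- The derivative of the right action of the inverse bisection in coordinates. -/
def RInvDeriv : EuclideanSpace ℝ (Fin d) →L[ℝ] PhaseSpace n :=
  modelDeriv (𝓡 d) 𝓘(ℝ, PhaseSpace n) (P.chart ∘ S.RInv) (S.tgtSec y)

theorem RDeriv_RInvDeriv (v : EuclideanSpace ℝ (Fin d)) :
    S.RDeriv P (S.RInvDeriv P v) = v := by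
  refine modelDeriv_apply_of_eventually_leftInverse (S.contMDiffAt_R_chart_symm P)
    (S.contMDiffAt_chart_RInv P) (congrArg P.chart (S.RInv_tgtSec y)) ?_ v
  have h1 := (S.contMDiffAt_RInv y).continuousAt
  rw [ContinuousAt, S.RInv_tgtSec y] at h1
  filter_upwards [h1.eventually (P.chart.open_source.mem_nhds P.unit_mem),
    S.eventually_R_RInv y] with g hg hR
  rw [Function.comp_apply, Function.comp_apply, P.chart.left_inv hg, hR]

theorem RInvDeriv_RDeriv (v : PhaseSpace n) : S.RInvDeriv P (S.RDeriv P v) = v := by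
  refine modelDeriv_apply_of_eventually_leftInverse (S.contMDiffAt_chart_RInv P)
    (S.contMDiffAt_R_chart_symm P) ?_ ?_ v
  · rw [Function.comp_apply, P.symm_chart_unit, S.R_unit]
  have h1 := P.contMDiffAt_chart_symm.continuousAt
  rw [ContinuousAt, P.symm_chart_unit] at h1
  filter_upwards [h1.eventually (S.eventually_RInv_R y),
    P.chart.open_target.mem_nhds P.chart_unit_mem_target] with z hz hzt
  rw [Function.comp_apply, Function.comp_apply, hz, P.chart.right_inv hzt]

/-- The form `R_Σ^* ω` at the unit, in coordinates. -/
def actionForm : LinearMap.BilinForm ℝ (PhaseSpace n) :=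
  (𝒢.om.bilin (S.tgtSec y)).comp (S.RDeriv P).toLinearMap (S.RDeriv P).toLinearMap

theorem actionForm_apply (v w : PhaseSpace n) :
    S.actionForm P v w = 𝒢.om.val (S.tgtSec y) (S.RDeriv P v) (S.RDeriv P w) := rfl

theorem actionForm_isAlt : (S.actionForm P).IsAlt := fun _ => 𝒢.om.bilin_isAlt _ _

theorem RForm_eq (v w : PhaseSpace n) : S.RForm P v w = S.actionForm P v w := by
  have h : S.RForm P v w = (pullback 𝓘(ℝ, PhaseSpace n) (𝓡 d) P.chart.symm
    (pullback (𝓡 d) (𝓡 d) S.R 𝒢.om)).val (P.chart (𝒢.unit y)) v w := rfl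
  rw [h, val_pullback, val_pullback, P.symm_chart_unit, S.R_unit, actionForm_apply]
  unfold RDeriv
  rw [modelDeriv_comp_apply (S.contMDiffAt_R y) P.contMDiffAt_chart_symm P.symm_chart_unit,
    modelDeriv_comp_apply (S.contMDiffAt_R y) P.contMDiffAt_chart_symm P.symm_chart_unit]

/-- By multiplicativity `R_Σ^*ω` exceeds `ω` by the pull-back of `ω` along `Σ_t ∘ s`, which vanishes
as soon as one argument is a momentum direction. -/
theorem actionForm_inr_left (p : EuclideanSpace ℝ (Fin n)) (v : PhaseSpace n) :
    S.actionForm P (0, p) v = P.unitForm (0, p) v := by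
  have hσ : ContMDiffAt 𝓘(ℝ, PhaseSpace n) (𝓡 d) ∞
      (fun z => S.tgtSec (𝒢.src (P.chart.symm z))) (P.chart (𝒢.unit y)) :=
    (S.tgtSec_smooth.comp 𝒢.src_submersion.contMDiff).contMDiffAt.comp _ P.contMDiffAt_chart_symm
  have hc := P.contMDiffAt_chart_symm.continuousAt
  rw [ContinuousAt, P.symm_chart_unit] at hc
  have h := 𝒢.val_mul P.contMDiffAt_chart_symm hσ (k := S.R ∘ P.chart.symm)
    (hc.eventually (S.eventually_R_dom y)) (.of_forall fun z => rfl) (0, p) v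
  rw [P.modelDeriv_comp_src_chart_symm_apply S.tgtSec_smooth (0, p), map_zero,
    Function.comp_apply, P.symm_chart_unit, S.R_unit] at h
  rw [actionForm_apply, P.unitForm_apply]
  refine h.trans ?_
  have h0 := (𝒢.om.bilin (S.tgtSec (𝒢.src (𝒢.unit y)))).zero_left
    (modelDeriv 𝓘(ℝ, PhaseSpace n) (𝓡 d) (fun z => S.tgtSec (𝒢.src (P.chart.symm z)))
      (P.chart (𝒢.unit y)) v)
  rw [TwoForm.bilin_apply] at h0
  rw [h0, add_zero]
  rfl

/-- On the units `R_Σ` is `Σ_t`; this identifies the `xx`-block of `R_Σ^*ω` with `F^t`. -/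
theorem RDeriv_inl (e : EuclideanSpace ℝ (Fin n)) :
    S.RDeriv P (e, 0) = modelDeriv (𝓡 n) (𝓡 d) S.tgtSec y
      (modelDeriv (𝓡 n) (𝓡 n) P.base.symm (P.base y) e) := by
  rw [RDeriv, ← modelDeriv_comp_inl_apply (S.contMDiffAt_R_chart_symm P) P.chart_unit.symm,
    ← modelDeriv_comp_apply S.tgtSec_smooth.contMDiffAt P.contMDiffAt_base_symm
      (P.base.left_inv P.mem_base_source)]
  refine DFunLike.congr_fun (modelDeriv_congr ?_) e
  filter_upwards [P.eventually_chart_symm_eq_unit] with e he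
  rw [Function.comp_apply, Function.comp_apply, he, S.R_unit, Function.comp_apply]

theorem actionForm_inl_inl (e e' : EuclideanSpace ℝ (Fin n)) :
    S.actionForm P (e, 0) (e', 0) =
      S.Ft.val y (modelDeriv (𝓡 n) (𝓡 n) P.base.symm (P.base y) e)
        (modelDeriv (𝓡 n) (𝓡 n) P.base.symm (P.base y) e') := by
  rw [actionForm_apply, RDeriv_inl, RDeriv_inl, Ft, val_pullback]

theorem FtMatrix_apply (l m : Fin n) :
    S.FtMatrix P l m = S.actionForm P (EuclideanSpace.single l (1 : ℝ), 0)
      (EuclideanSpace.single m (1 : ℝ), 0) := by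
  have h : S.FtMatrix P l m = (pullback (𝓡 n) (𝓡 n) P.base.symm S.Ft).val (P.base y)
    (EuclideanSpace.single l (1 : ℝ)) (EuclideanSpace.single m (1 : ℝ)) := rfl
  rw [h, val_pullback, actionForm_inl_inl, P.base.left_inv P.mem_base_source]

theorem Ft_val_eq_zero_of_FtMatrix_eq_zero (h : S.FtMatrix P = 0) (v w : EuclideanSpace ℝ (Fin n)) :
    S.Ft.val y v w = 0 := by
  have hb : ∀ u, modelDeriv (𝓡 n) (𝓡 n) P.base.symm (P.base y)
      (modelDeriv (𝓡 n) (𝓡 n) P.base y u) = u :=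
    modelDeriv_apply_of_eventually_leftInverse P.contMDiffAt_base_symm P.contMDiffAt_base rfl
      (P.base.eventually_left_inverse P.mem_base_source)
  have hneg : ∀ v w, S.actionForm P v w = - S.actionForm P w v :=
    fun v w => (LinearMap.IsAlt.neg (S.actionForm_isAlt P) w v).symm
  rw [← hb v, ← hb w, ← actionForm_inl_inl, bilin_eq_sum]
  have h1 : ∀ l e, S.actionForm P (EuclideanSpace.single l (1 : ℝ), 0) (e, 0) = 0 := by
    intro l e
    rw [hneg, bilin_eq_sum]
    simp [← FtMatrix_apply, h]
  simp [h1]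

theorem FtMatrix_eq_zero_of_Ft_eq_zero (h : S.Ft = 0) : S.FtMatrix P = 0 := by
  ext l m
  rw [FtMatrix_apply, actionForm_inl_inl, h]
  rfl

/-- The mixed block of `R_Σ^*ω` equals that of `ω` at the unit, where the units are isotropic and
`ω` is non-degenerate. -/
theorem isUnit_Gam : IsUnit (S.Gam P) := by
  refine isUnit_of_isotropic_of_nondegenerate P.unitForm_isAlt P.unitForm_nondegenerate
    P.unitForm_inl_inl fun m l => ?_
  rw [← S.actionForm_inr_left, ← RForm_eq]
  rfl

theorem modelDeriv_gaugeMomentum (j : Fin n) (v : EuclideanSpace ℝ (Fin d)) :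
    modelDeriv (𝓡 d) 𝓘(ℝ, ℝ) (S.gaugeMomentum P j) (S.tgtSec y) v = (S.RInvDeriv P v).2 j := by
  let π : PhaseSpace n →L[ℝ] ℝ :=
    (EuclideanSpace.proj j).comp (ContinuousLinearMap.snd ℝ _ _)
  have h : modelDeriv (𝓡 d) 𝓘(ℝ, ℝ) (π ∘ (P.chart ∘ S.RInv)) (S.tgtSec y) v =
      π (S.RInvDeriv P v) := by
    rw [modelDeriv_comp_apply π.contDiff.contMDiff.contMDiffAt (S.contMDiffAt_chart_RInv P) rfl,
      modelDeriv_eq_fderiv, π.fderiv]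
    rfl
  exact h

/-- The vector of coordinates that represents `dp_j` with respect to `R_Σ^* ω`. -/
def momentumVector (j : Fin n) : PhaseSpace n :=
  S.RInvDeriv P (𝒢.om.dualVector (S.tgtSec y)
    (modelDeriv (𝓡 d) 𝓘(ℝ, ℝ) (S.gaugeMomentum P j) (S.tgtSec y)))

/-- The defining equation `ω(X, ·) = dΠ_j` of the Hamiltonian vector, pulled back by `R_Σ`, which
carries `Π_j` to `p_j`. -/
theorem actionForm_momentumVector (j : Fin n) (w : PhaseSpace n) :
    S.actionForm P (S.momentumVector P j) w = w.2 j := by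
  rw [actionForm_apply, momentumVector, RDeriv_RInvDeriv]
  refine (TwoForm.val_dualVector (𝒢.val_nondegenerate (S.tgtSec y)) _ _).trans ?_
  rw [modelDeriv_gaugeMomentum, RInvDeriv_RDeriv]

theorem momentumVector_snd (j k : Fin n) :
    (S.momentumVector P j).2 k = poissonBracket 𝒢.om (S.gaugeMomentum P j) (S.gaugeMomentum P k)
      (S.tgtSec y) :=
  (S.modelDeriv_gaugeMomentum P k _).symm

/-- The bracket at `Σ_s(x)` is computed at the image of the unit at `l_Σ(x)` under `R_Σ`, since
`Σ_t(l_Σ(x)) = Σ_s(x)`. There the momentum components of the Hamiltonian vectors are the entries of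
`𝓕`, and the block equations apply. -/
theorem calF_relation (P : ∀ y : X, MomentumChart 𝒢 y) (x : X)
    {F Γ Ξ N K : Matrix (Fin n) (Fin n) ℝ} (hF : F = S.FtMatrix (P (S.l x)))
    (hΓ : Γ = S.Gam (P (S.l x))) (hΞ : Ξ = S.Xi (P (S.l x)))
    (hN : N = (Γ⁻¹)ᵀ * F * Γ⁻¹) (hK : K = Γᵀ * S.calF P x * Γ) :
    IsUnit Γ ∧
      IsUnit (1 + N * Ξ) ∧ S.calF P x = (1 + N * Ξ)⁻¹ * N ∧
      IsUnit (1 - K * (Γ⁻¹ * Ξ * (Γ⁻¹)ᵀ)) ∧ F = (1 - K * (Γ⁻¹ * Ξ * (Γ⁻¹)ᵀ))⁻¹ * K := by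
  have hU : IsUnit Γ := hΓ ▸ S.isUnit_Gam _
  obtain ⟨h₁, h₂⟩ := block_equations (S.actionForm_isAlt (P (S.l x)))
    (F := F) (Γ := Γ) (Ξ := Ξ) (Φ := S.calF P x)
    (a := Matrix.of fun j l => (S.momentumVector (P (S.l x)) j).1 l)
    (fun l m => by rw [hF, FtMatrix_apply])
    (fun m l => by rw [hΓ, ← RForm_eq]; rfl) (fun l m => by rw [hΞ, ← RForm_eq]; rfl)
    (S.actionForm_momentumVector (P (S.l x))) (fun j l => rfl)
    (fun j k => by rw [momentumVector_snd, tgtSec_l]; rfl)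
  exact ⟨hU, isUnit_and_schur_of_block_inverse hU h₁ h₂ hN hK⟩

theorem Ft_eq_zero_iff_calF_eq_zero (P : ∀ y : X, MomentumChart 𝒢 y) :
    S.Ft = 0 ↔ ∀ x, S.calF P x = 0 := by
  constructor
  · intro h x
    have hF := S.FtMatrix_eq_zero_of_Ft_eq_zero (P (S.l x)) h
    rw [(S.calF_relation P x rfl rfl rfl rfl rfl).2.2.1, hF]
    simp
  · intro h
    rw [TwoForm.eq_zero_iff]
    intro y
    -- The matrix relation reaches only points of the form `l_Σ(x)`; these are all points, as `l_Σ ∘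
    -- r_Σ = id`.
    obtain ⟨x, rfl⟩ : ∃ x, S.l x = y := ⟨_, S.l_r y⟩
    refine S.Ft_val_eq_zero_of_FtMatrix_eq_zero (P (S.l x)) ?_
    rw [(S.calF_relation P x rfl rfl rfl rfl rfl).2.2.2.2, h x]
    simp

end Bisection

end Charts

end PoissonED

end

theorem mainTheorem3 {n d : ℕ} {G X : Type*}
    [TopologicalSpace G] [ChartedSpace (EuclideanSpace ℝ (Fin d)) G] [IsManifold (𝓡 d) ∞ G]
    [TopologicalSpace X] [ChartedSpace (EuclideanSpace ℝ (Fin n)) X] [IsManifold (𝓡 n) ∞ X]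
    (𝒢 : LocalSymplecticGroupoid n d G X) (S : Bisection 𝒢) (P : ∀ y : X, MomentumChart 𝒢 y) :
    -- simultaneous vanishing, and vanishing exactly for Lagrangian bisections
    ((S.Fs = 0 ↔ S.Ft = 0) ∧
      (S.Ft = 0 ↔ ∀ x, S.calF P x = 0) ∧
      (S.Fs = 0 ↔ IsLagrangianSubmanifold (𝓡 d) 𝒢.om S.carrier)) ∧
    -- relations between the two pulled-back field strengths
    (S.Ft = pullback (𝓡 n) (𝓡 n) S.r S.Fs ∧ S.Fs = pullback (𝓡 n) (𝓡 n) S.l S.Ft) ∧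
    -- invertible relation between `𝓕(x)` and `F^t(l_Σ(x))`
    (∀ x : X, ∀ F Γ Ξ N K : Matrix (Fin n) (Fin n) ℝ,
      F = S.FtMatrix (P (S.l x)) → Γ = S.Gam (P (S.l x)) → Ξ = S.Xi (P (S.l x)) →
      N = (Γ⁻¹)ᵀ * F * Γ⁻¹ → K = Γᵀ * S.calF P x * Γ →
      IsUnit Γ ∧
      IsUnit (1 + N * Ξ) ∧ S.calF P x = (1 + N * Ξ)⁻¹ * N ∧
      IsUnit (1 - K * (Γ⁻¹ * Ξ * (Γ⁻¹)ᵀ)) ∧ F = (1 - K * (Γ⁻¹ * Ξ * (Γ⁻¹)ᵀ))⁻¹ * K) :=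
  ⟨⟨S.Fs_eq_zero_iff_Ft_eq_zero, S.Ft_eq_zero_iff_calF_eq_zero P,
    S.Fs_eq_zero_iff_isLagrangian fun x => (P x).dim_eq⟩,
    ⟨S.Ft_eq_pullback, S.Fs_eq_pullback⟩,
    fun x _ _ _ _ _ hF hΓ hΞ hN hK => S.calF_relation P x hF hΓ hΞ hN hK⟩
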